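/- Let $m_1,\dots,m_4\ge 1$ be arbitrary integers, let $g=T_1^{m_1}+T_2^{m_2}+T_3^{m_3}+T_4^{m_4}\in\mathbb C[T_1,\dots,T_4]$ and let $R=\mathbb C[T_1,\dots,T_4]/\langle g\rangle$. Let $M\subseteq\mathbb Z^4$ be the subgroup generated by $(-m_1,m_2,0,0)$, $(-m_1,0,m_3,0)$ and $(-m_1,0,0,m_4)$, let $K=\mathbb Z^4/M$, and grade $\mathbb C[T_1,\dots,T_4]$ by $K$ through $\deg T_i=e_i+M$, where $e_1,\dots,e_4$ is the standard basis of $\mathbb Z^4$. For $w\in K$ let $R_w\subseteq R$ be the image of the space of polynomials that are homogeneous of degree $w$. Then $R$ is a normal integral domain, $g$ is $K$-homogeneous of degree $m_1e_1+M$, the class of each $T_i$ lies in $R_{e_i+M}$ and is a prime element of $R$, and $R$ is factorially $K$-graded by $(R_w)_{w\in K}$ (whether or not $R$ is a unique factorization domain). Here "factorially $K$-graded" means: $R=\bigoplus_{w\in K}R_w$ with $1\in R_0$ and $R_vR_w\subseteq R_{v+w}$; a product of two nonzero homogeneous elements is nonzero; and every nonzero homogeneous non-unit of $R$ is a finite product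 of $K$-primes, where a $K$-prime is a nonzero homogeneous non-unit $f$ such that $f\mid ab$ with $a,b$ homogeneous implies $f\mid a$ or $f\mid b$. -/

import Mathlib

section GradedFactoriality

variable {A R K : Type*} [CommRing A] [CommRing R] [Algebra A R] [AddCommGroup K]

/-- A nonzero homogeneous nonunit `f` is `K`-prime if, whenever it divides a product of two
homogeneous elements, it divides one of the factors. -/
structure IsGradedPrime (𝒜 : K → Submodule A R) (f : R) : Prop where
  homogeneous : SetLike.IsHomogeneousElem 𝒜 f
  ne_zero : f ≠ 0
  not_isUnit : ¬ IsUnit f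
  dvd_or_dvd : ∀ g h : R, SetLike.IsHomogeneousElem 𝒜 g → SetLike.IsHomogeneousElem 𝒜 h →
    f ∣ g * h → f ∣ g ∨ f ∣ h

open Classical in
/-- The family `𝒜` of submodules makes `R` a factorially `K`-graded `A`-algebra: `𝒜` is a
`K`-grading of `R`, there are no homogeneous zero divisors, and every nonzero homogeneous nonunit
is a product of `K`-primes. -/
structure IsFactoriallyGraded (𝒜 : K → Submodule A R) : Prop where
  graded : Nonempty (GradedAlgebra 𝒜)
  eq_zero_or_eq_zero : ∀ g h : R, SetLike.IsHomogeneousElem 𝒜 g →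
    SetLike.IsHomogeneousElem 𝒜 h → g * h = 0 → g = 0 ∨ h = 0
  exists_factors : ∀ f : R, SetLike.IsHomogeneousElem 𝒜 f → f ≠ 0 → ¬ IsUnit f →
    ∃ s : Multiset R, (∀ p ∈ s, IsGradedPrime 𝒜 p) ∧ s.prod = f

end GradedFactoriality

noncomputable section

namespace Brieskorn

/-- The polynomial `T₁ ^ m₁ + T₂ ^ m₂ + T₃ ^ m₃ + T₄ ^ m₄` (with indices `0, 1, 2, 3`). -/
def poly (m : Fin 4 → ℕ) : MvPolynomial (Fin 4) ℂ :=
  ∑ i, MvPolynomial.X i ^ m i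

/-- The ring `ℂ[T₁, …, T₄] / ⟨T₁ ^ m₁ + … + T₄ ^ m₄⟩`. -/
abbrev Ring (m : Fin 4 → ℕ) : Type :=
  MvPolynomial (Fin 4) ℂ ⧸ Ideal.span {poly m}

/-- The class of the variable `Tᵢ`. -/
def var (m : Fin 4 → ℕ) (i : Fin 4) : Ring m :=
  Ideal.Quotient.mk (Ideal.span {poly m}) (MvPolynomial.X i)

/-- The sublattice `M` of `ℤ⁴`. -/
def lattice (m : Fin 4 → ℕ) : AddSubgroup (Fin 4 → ℤ) :=
  AddSubgroup.closure
    {![-(m 0 : ℤ), (m 1 : ℤ), 0, 0], ![-(m 0 : ℤ), 0, (m 2 : ℤ), 0],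
      ![-(m 0 : ℤ), 0, 0, (m 3 : ℤ)]}

/-- The grading group `K = ℤ⁴ / M`. -/
abbrev DegreeGroup (m : Fin 4 → ℕ) : Type :=
  (Fin 4 → ℤ) ⧸ lattice m

/-- The degree `eᵢ + M` of the variable `Tᵢ`. -/
def degree (m : Fin 4 → ℕ) (i : Fin 4) : DegreeGroup m :=
  QuotientAddGroup.mk (Pi.single i (1 : ℤ))

/-- The homogeneous component of degree `w` of the quotient ring: the classes of the polynomials
all of whose monomials have degree `w`, where `Tᵢ` has degree `eᵢ + M`. -/
def grading (m : Fin 4 → ℕ) (w : DegreeGroup m) : Submodule ℂ (Ring m) :=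
  (MvPolynomial.weightedHomogeneousSubmodule ℂ (degree m) w).map
    (Ideal.Quotient.mkₐ ℂ (Ideal.span {poly m})).toLinearMap

end Brieskorn

end

/-! Normality and primality come from Eisenstein's criterion. Isolating one variable gives `g = X ^
n + h`. A sum of at least two powers is squarefree (take a partial derivative), so `g` is Eisenstein
at a factor of `h`, and sums of at least three powers are prime. With four variables `h` itself is
prime, and the discriminant of `X ^ n + h` is a unit times a power of `h`, so Eisenstein at `h`
makes `R` normal. Setting `T_i = 0` leaves a prime sum of three powers, so `T_i` is prime.

For factoriality, map `S = ℂ[y₀, y₁, y₂]` to `R` by `y_j ↦ T_j ^ m_j` (`powHom`). This is injective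
and integral, and four linear forms map to the four powers `T_i ^ m_i`. Equality of degrees modulo
`M` makes every homogeneous element `T ^ r * powHom F` with `F` homogeneous
(`exists_eq_prod_var_mul_powHom`). Factor `F` in `S`: a prime associated to a linear form gives a
power of a `T_i`, and any other gives a `K`-prime (`isGradedPrime_powHom`), because divisibility
descends from `R` to the normal ring `S`. -/

/-! ### Eisenstein polynomials `X ^ n + h` and normality of root adjunctions -/

open Polynomial in
theorem isEisensteinAt_X_pow_add_C {A : Type*} [CommRing A] [IsDomain A] {h p : A}
    (hp : Prime p) (hph : p ∣ h) (hsq : ¬ p ^ 2 ∣ h) {n : ℕ} (hn : n ≠ 0) :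
    (X ^ n + C h : A[X]).IsEisensteinAt (Ideal.span {p}) where
  leading := by
    rw [leadingCoeff_X_pow_add_C (Nat.pos_of_ne_zero hn), Ideal.mem_span_singleton]
    exact fun hd => hp.not_isUnit (isUnit_of_dvd_one hd)
  mem {k} hk := by
    rw [natDegree_X_pow_add_C] at hk
    rw [coeff_add, coeff_X_pow, if_neg hk.ne, zero_add, coeff_C, Ideal.mem_span_singleton]
    split_ifs
    · exact hph
    · exact dvd_zero _
  notMem := by
    rw [Ideal.span_singleton_pow, Ideal.mem_span_singleton]
    simpa [coeff_X_pow, hn.symm] using hsq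

open Polynomial in
theorem irreducible_X_pow_add_C {A : Type*} [CommRing A] [IsDomain A] {h p : A}
    (hp : Prime p) (hph : p ∣ h) (hsq : ¬ p ^ 2 ∣ h) {n : ℕ} (hn : n ≠ 0) :
    Irreducible (X ^ n + C h : A[X]) :=
  (isEisensteinAt_X_pow_add_C hp hph hsq hn).irreducible
    ((Ideal.span_singleton_prime hp.ne_zero).2 hp) (monic_X_pow_add_C h hn).isPrimitive
    (by rw [natDegree_X_pow_add_C]; exact Nat.pos_of_ne_zero hn)

theorem Prime.not_sq_dvd_self {A : Type*} [CommRing A] [IsDomain A] {p : A} (hp : Prime p) :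
    ¬ p ^ 2 ∣ p := by
  rintro ⟨c, hc⟩
  refine hp.not_isUnit (IsUnit.of_mul_eq_one c (mul_left_cancel₀ hp.ne_zero ?_))
  rw [mul_one]
  conv_rhs => rw [hc]
  ring

-- The generator has norm `± h` and the derivative is `n X ^ (n - 1)` with `n` invertible, so the
-- discriminant is a unit times `h ^ (n - 1)`. Hence `h ^ (n - 1) z` lies in the adjunction for each
-- integral `z`, and the Eisenstein property at `h` removes the power of `h`.
open Polynomial in
theorem integralClosure_eq_adjoin_of_minpoly_eq_X_pow_add_C {A K L : Type*} [CommRing A] [IsDomain A]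
    [IsIntegrallyClosed A] [Algebra ℚ A] [Field K] [Algebra A K] [IsFractionRing A K] [Field L]
    [Algebra K L] [Algebra A L] [IsScalarTower A K L] {h : A} (hh : Prime h) {n : ℕ} (hn : n ≠ 0)
    (B : PowerBasis K L) (hB : minpoly A B.gen = X ^ n + C h) :
    integralClosure A L = Algebra.adjoin A ({B.gen} : Set L) := by
  have : Module.Finite K L := B.finite
  have : CharZero A := algebraRat.charZero A
  have : CharZero K := charZero_of_injective_algebraMap (IsFractionRing.injective A K)
  have hint : IsIntegral A B.gen := by
    by_contra hc
    exact (monic_X_pow_add_C h hn).ne_zero (hB ▸ minpoly.eq_zero hc)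
  have hgenK : minpoly K B.gen = (X ^ n + C h : A[X]).map (algebraMap A K) := by
    rw [minpoly.isIntegrallyClosed_eq_field_fractions' K hint, hB]
  have hnorm : Algebra.norm K B.gen = (-1) ^ B.dim * algebraMap A K h := by
    rw [Algebra.PowerBasis.norm_gen_eq_coeff_zero_minpoly, hgenK, coeff_map]
    simp [coeff_X_pow, hn.symm]
  have hnu : IsUnit (n : A) := by
    have : IsUnit (n : ℚ) := by simpa using hn
    simpa using this.map (algebraMap ℚ A)
  have hdiscr : ∃ u : A, IsUnit u ∧
      Algebra.discr K B.basis = algebraMap A K (u * h ^ (n - 1)) := by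
    rw [Algebra.discr_powerBasis_eq_norm, hgenK, derivative_map]
    simp only [derivative_add, derivative_X_pow, derivative_C, add_zero, aeval_map_algebraMap,
      map_mul, map_pow, aeval_X, hnorm, map_natCast]
    have : ((n : L)) = algebraMap K L (algebraMap A K n) := by simp
    rw [this, Algebra.norm_algebraMap]
    refine ⟨(-1) ^ (Module.finrank K L * (Module.finrank K L - 1) / 2) *
      (n ^ (Module.finrank K L) * ((-1) ^ B.dim) ^ (n - 1)), ?_, ?_⟩
    · exact (isUnit_one.neg.pow _).mul ((hnu.pow _).mul ((isUnit_one.neg.pow _).pow _))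
    · simp only [map_mul, map_pow, map_neg, map_one, map_natCast]
      ring
  refine le_antisymm (fun z hz => ?_) (adjoin_le_integralClosure hint)
  obtain ⟨_, ⟨v, rfl⟩, hd⟩ := hdiscr
  have h1 := Algebra.discr_mul_isIntegral_mem_adjoin K (B := B) hint hz
  rw [hd, algebraMap_smul, mul_smul] at h1
  have h2 := Subalgebra.smul_mem _ h1 (↑v⁻¹ : A)
  rw [smul_smul, Units.inv_mul, one_smul] at h2
  exact mem_adjoin_of_smul_prime_pow_smul_of_minpoly_isEisensteinAt (K := K) (B := B) hh hint hz h2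
    (by rw [hB]; exact isEisensteinAt_X_pow_add_C hh dvd_rfl hh.not_sq_dvd_self hn)

open Polynomial in
/-- Adjoining an `n`-th root of the negative of a prime to an integrally closed `ℚ`-algebra yields
an integrally closed ring. -/
theorem isIntegrallyClosed_adjoinRoot_X_pow_add_C {A : Type*} [CommRing A] [IsDomain A]
    [IsIntegrallyClosed A] [Algebra ℚ A] {h : A} (hh : Prime h) {n : ℕ} (hn : n ≠ 0) :
    IsIntegrallyClosed (AdjoinRoot (X ^ n + C h : A[X])) := by
  let K := FractionRing A
  have hmonic : (X ^ n + C h : A[X]).Monic := monic_X_pow_add_C h hn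
  obtain ⟨F, hF⟩ : ∃ F : K[X], F = (X ^ n + C h : A[X]).map (algebraMap A K) := ⟨_, rfl⟩
  have hFirr : Irreducible F := hF ▸ hmonic.irreducible_iff_irreducible_map_fraction_map.1
    (irreducible_X_pow_add_C hh dvd_rfl hh.not_sq_dvd_self hn)
  have hFmonic : F.Monic := hF ▸ hmonic.map _
  have : Fact (Irreducible F) := ⟨hFirr⟩
  let L := AdjoinRoot F
  let B : PowerBasis K L := AdjoinRoot.powerBasis hFirr.ne_zero
  have : Module.Finite K L := B.finite
  have : Module.IsTorsionFree A L := .trans_faithfulSMul A K L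
  have hgenK : minpoly K B.gen = F := by
    rw [AdjoinRoot.minpoly_powerBasis_gen, hFmonic.leadingCoeff, inv_one, C_1, mul_one]
  have hint : IsIntegral A B.gen := by
    refine ⟨_, hmonic, ?_⟩
    have := (congrArg (aeval B.gen) hgenK).symm.trans (minpoly.aeval K B.gen)
    rw [congrArg (aeval B.gen) hF, aeval_map_algebraMap] at this
    exact this
  have hgenA : minpoly A B.gen = X ^ n + C h := by
    apply map_injective _ (IsFractionRing.injective A K)
    rw [← minpoly.isIntegrallyClosed_eq_field_fractions' K hint, hgenK, hF]
  -- The adjunction of the root is isomorphic to `A[B.gen]`, which is the whole integral closure of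
  -- `A` in `L`.
  have : IsIntegrallyClosed (integralClosure A L) :=
    integralClosure.isIntegrallyClosedOfFiniteExtension K
  have e := minpoly.equivAdjoin hint
  rw [hgenA] at e
  rw [integralClosure_eq_adjoin_of_minpoly_eq_X_pow_add_C hh hn B hgenA] at this
  exact IsIntegrallyClosed.of_equiv e.symm.toRingEquiv

/-! ### Sums of powers of variables -/

namespace MvPolynomial

variable {σ k : Type*}

/-- The polynomial ring as a univariate polynomial ring in the variable `X i`. -/
noncomputable def isolate [DecidableEq σ] (k : Type*) [CommSemiring k] (i : σ) :
    MvPolynomial σ k ≃ₐ[k] Polynomial (MvPolynomial {j // j ≠ i} k) :=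
  (renameEquiv k (Equiv.optionSubtypeNe i).symm).trans (optionEquivLeft k _)

theorem isolate_X_self [DecidableEq σ] [CommSemiring k] (i : σ) :
    isolate k i (X i) = Polynomial.X := by
  simp [isolate, optionEquivLeft_X_none]

theorem isolate_X_coe [DecidableEq σ] [CommSemiring k] {i : σ} (j : {j // j ≠ i}) :
    isolate k i (X (j : σ)) = Polynomial.C (X j) := by
  simp [isolate, Equiv.optionSubtypeNe_symm_of_ne j.2, optionEquivLeft_X_some]

theorem isolate_sum_X_pow [DecidableEq σ] [CommSemiring k] (m : σ → ℕ) {s : Finset σ} {i : σ}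
    (hi : i ∈ s) :
    isolate k i (∑ j ∈ s, X j ^ m j) = Polynomial.X ^ m i +
      Polynomial.C (∑ j ∈ s.subtype (· ≠ i), X j ^ m j) := by
  rw [← Finset.add_sum_erase s _ hi, map_add, map_pow, isolate_X_self, map_sum, map_sum,
    ← Finset.filter_ne', ← Finset.sum_subtype_eq_sum_filter]
  simp only [map_pow, isolate_X_coe]

theorem prime_X_var [CommRing k] [IsDomain k] (i : σ) : Prime (X i : MvPolynomial σ k) := by
  classical
  rw [← MulEquiv.prime_iff (isolate k i), isolate_X_self]
  exact Polynomial.prime_X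

theorem eval_single_sum_X_pow [DecidableEq σ] [CommSemiring k] {m : σ → ℕ} (hm : ∀ i, m i ≠ 0)
    {s : Finset σ} {i : σ} (hi : i ∈ s) :
    eval (Pi.single i (1 : k)) (∑ j ∈ s, X j ^ m j) = 1 := by
  simp only [map_sum, map_pow, eval_X]
  rw [Finset.sum_eq_single_of_mem i hi fun j _ hj => ?_, Pi.single_eq_same, one_pow]
  rw [Pi.single_eq_of_ne hj, zero_pow (hm j)]

theorem sum_X_pow_ne_zero [CommSemiring k] [Nontrivial k] {m : σ → ℕ} (hm : ∀ i, m i ≠ 0)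
    {s : Finset σ} (hs : s.Nonempty) : (∑ j ∈ s, X j ^ m j : MvPolynomial σ k) ≠ 0 := by
  classical
  obtain ⟨i, hi⟩ := hs
  intro h
  have := eval_single_sum_X_pow (k := k) hm hi
  rw [h, map_zero] at this
  exact zero_ne_one this

theorem not_isUnit_sum_X_pow [CommSemiring k] [Nontrivial k] {m : σ → ℕ} (hm : ∀ i, m i ≠ 0)
    (s : Finset σ) : ¬ IsUnit (∑ j ∈ s, X j ^ m j : MvPolynomial σ k) := by
  intro h
  have := h.map (eval (0 : σ → k))
  simp [zero_pow (hm _)] at this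

theorem not_X_dvd_sum_X_pow [CommSemiring k] [Nontrivial k] {m : σ → ℕ} (hm : ∀ i, m i ≠ 0)
    {s : Finset σ} {i j : σ} (hj : j ∈ s) (hij : i ≠ j) :
    ¬ (X i : MvPolynomial σ k) ∣ ∑ j ∈ s, X j ^ m j := by
  classical
  rintro ⟨q, hq⟩
  have := eval_single_sum_X_pow (k := k) hm hj
  rw [hq, map_mul, eval_X, Pi.single_eq_of_ne hij, zero_mul] at this
  exact zero_ne_one this

theorem pderiv_sum_X_pow [DecidableEq σ] [CommSemiring k] (m : σ → ℕ) {s : Finset σ} {i : σ}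
    (hi : i ∈ s) :
    pderiv i (∑ j ∈ s, X j ^ m j : MvPolynomial σ k) = C (m i : k) * X i ^ (m i - 1) := by
  rw [map_sum, Finset.sum_eq_single_of_mem i hi fun j _ hj => ?_]
  · simp
  · simp [pderiv_X_of_ne hj]

/-- A prime whose square divides the sum also divides its derivative `m_i X_i ^ (m_i - 1)`, hence is
associated to `X_i`. But `X_i` does not divide a sum that involves another variable. -/
theorem not_sq_dvd_sum_X_pow [Field k] [CharZero k] {m : σ → ℕ} (hm : ∀ i, m i ≠ 0)
    {s : Finset σ} (hs : s.Nontrivial) {p : MvPolynomial σ k} (hp : Prime p) :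
    ¬ p ^ 2 ∣ ∑ j ∈ s, X j ^ m j := by
  classical
  obtain ⟨i, hi, j, hj, hij⟩ := hs
  rintro ⟨q, hq⟩
  have hd := pderiv_sum_X_pow (k := k) m hi
  rw [hq] at hd
  have hpd : p ∣ C (m i : k) * X i ^ (m i - 1) := by
    rw [← hd, (pderiv i).leibniz, pderiv_pow]
    simp only [smul_eq_mul, Nat.add_one_sub_one, pow_one]
    exact ⟨p * pderiv i q + q * (↑2 * pderiv i p), by push_cast; ring⟩
  have hunit : IsUnit (C (m i : k) : MvPolynomial σ k) :=
    (isUnit_iff_ne_zero.2 (Nat.cast_ne_zero.2 (hm i))).map C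
  have hpX : p ∣ X i := hp.dvd_of_dvd_pow (hunit.dvd_mul_left.1 hpd)
  have hXp : X i ∣ p := ((prime_X_var i).irreducible.dvd_iff.1 hpX).resolve_left hp.not_isUnit |>.dvd
  refine not_X_dvd_sum_X_pow (k := k) hm hj hij (hXp.trans ?_)
  exact hq ▸ (dvd_pow_self p two_ne_zero).mul_right q

/-- A sum of powers of at least three variables is irreducible in characteristic zero. -/
theorem prime_sum_X_pow [Field k] [CharZero k] {m : σ → ℕ} (hm : ∀ i, m i ≠ 0)
    {s : Finset σ} (hs : 2 < s.card) : Prime (∑ j ∈ s, X j ^ m j : MvPolynomial σ k) := by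
  classical
  obtain ⟨i, hi⟩ : s.Nonempty := Finset.card_pos.1 (by omega)
  have ht : (s.subtype (· ≠ i)).Nontrivial := by
    rw [← Finset.one_lt_card_iff_nontrivial, Finset.card_subtype, Finset.filter_ne',
      Finset.card_erase_of_mem hi]
    omega
  have hm' : ∀ j : {j // j ≠ i}, m j ≠ 0 := fun j => hm j
  -- At least two variables remain, so any irreducible factor of the remaining sum divides it
  -- exactly once.
  obtain ⟨p, hp, hph⟩ := WfDvdMonoid.exists_irreducible_factor
    (not_isUnit_sum_X_pow (k := k) hm' (s.subtype (· ≠ i))) (sum_X_pow_ne_zero hm' ht.nonempty)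
  rw [← MulEquiv.prime_iff (isolate k i), ← irreducible_iff_prime, isolate_sum_X_pow m hi]
  exact irreducible_X_pow_add_C hp.prime hph (not_sq_dvd_sum_X_pow hm' ht hp.prime) (hm i)

/-- A quotient of a polynomial ring by a sum of powers of at least four variables is integrally
closed in characteristic zero. -/
theorem isIntegrallyClosed_quotient_sum_X_pow [Field k] [CharZero k] {m : σ → ℕ}
    (hm : ∀ i, m i ≠ 0) {s : Finset σ} (hs : 3 < s.card) :
    IsIntegrallyClosed (MvPolynomial σ k ⧸ Ideal.span {(∑ j ∈ s, X j ^ m j : MvPolynomial σ k)}) := by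
  classical
  obtain ⟨i, hi⟩ : s.Nonempty := Finset.card_pos.1 (by omega)
  have ht : 2 < (s.subtype (· ≠ i)).card := by
    rw [Finset.card_subtype, Finset.filter_ne', Finset.card_erase_of_mem hi]
    omega
  have hm' : ∀ j : {j // j ≠ i}, m j ≠ 0 := fun j => hm j
  have h := isIntegrallyClosed_adjoinRoot_X_pow_add_C (prime_sum_X_pow (k := k) hm' ht) (hm i)
  refine @IsIntegrallyClosed.of_equiv _ _ _ _ (Ideal.quotientEquiv _ _
    (isolate k i).toRingEquiv ?_).symm h
  rw [Ideal.map_span, Set.image_singleton]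
  exact congrArg (fun x => Ideal.span {x}) (isolate_sum_X_pow m hi).symm

/-! ### Factors of homogeneous polynomials -/

/-- The ring homomorphism `X i ↦ X i * t`, recording the homogeneous components as coefficients. -/
noncomputable def homogenization (σ k : Type*) [CommSemiring k] :
    MvPolynomial σ k →ₐ[k] Polynomial (MvPolynomial σ k) :=
  aeval fun i => Polynomial.C (X i) * Polynomial.X

theorem homogenization_monomial [CommSemiring k] (d : σ →₀ ℕ) (a : k) :
    homogenization σ k (monomial d a) = Polynomial.C (monomial d a) * Polynomial.X ^ d.degree := by
  rw [homogenization, aeval_monomial, Polynomial.algebraMap_apply, algebraMap_eq]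
  simp only [mul_pow, monomial_eq, map_mul, Finsupp.prod, map_prod, map_pow,
    Finset.prod_mul_distrib, Finset.prod_pow_eq_pow_sum, Finsupp.degree_apply, mul_assoc]

theorem coeff_homogenization [CommSemiring k] (p : MvPolynomial σ k) (n : ℕ) :
    (homogenization σ k p).coeff n = homogeneousComponent n p := by
  classical
  induction p using MvPolynomial.induction_on' with
  | monomial d a =>
    rw [homogenization_monomial, Polynomial.coeff_C_mul_X_pow]
    rw [homogeneousComponent_of_mem (isHomogeneous_monomial a rfl)]
  | add p q hp hq => rw [map_add, Polynomial.coeff_add, hp, hq, map_add]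

/-- Factors of a nonzero homogeneous polynomial over a domain are homogeneous. -/
theorem IsHomogeneous.exists_of_mul [CommRing k] [IsDomain k] {p q : MvPolynomial σ k} {n : ℕ}
    (h : (p * q).IsHomogeneous n) (h0 : p * q ≠ 0) : ∃ d, p.IsHomogeneous d := by
  have hcoeff (j : ℕ) (hj : (homogenization σ k (p * q)).coeff j ≠ 0) : j = n := by
    classical
    rw [coeff_homogenization, homogeneousComponent_of_mem h] at hj
    exact (ite_ne_right_iff.1 hj).1
  have hne : homogenization σ k (p * q) ≠ 0 := by
    intro h'
    have := coeff_homogenization (p * q) n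
    rw [h', homogeneousComponent_eq_self h, Polynomial.coeff_zero] at this
    exact h0 this.symm
  -- Lowest and highest degree of the product are both `n`. Each is additive over the factors, so
  -- they must agree for each factor.
  have hdeg := hcoeff _ (Polynomial.leadingCoeff_ne_zero.2 hne)
  have htdeg := hcoeff _ (Polynomial.trailingCoeff_nonzero_iff_nonzero.2 hne)
  rw [map_mul] at hne hdeg htdeg
  have hp := left_ne_zero_of_mul hne
  have hq := right_ne_zero_of_mul hne
  rw [Polynomial.natDegree_mul hp hq] at hdeg
  rw [Polynomial.natTrailingDegree_mul hp hq] at htdeg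
  have h1 := Polynomial.natTrailingDegree_le_natDegree (homogenization σ k p)
  have h2 := Polynomial.natTrailingDegree_le_natDegree (homogenization σ k q)
  refine ⟨(homogenization σ k p).natDegree, fun e he => ?_⟩
  have hc : (homogenization σ k p).coeff e.degree ≠ 0 := by
    classical
    intro hc
    rw [coeff_homogenization] at hc
    have := coeff_homogeneousComponent e.degree p e
    rw [hc, coeff_zero, if_pos rfl] at this
    exact he this.symm
  have h3 := Polynomial.le_natDegree_of_ne_zero hc
  have h4 := Polynomial.natTrailingDegree_le_of_ne_zero hc
  rw [Pi.one_def, ← Finsupp.degree_eq_weight_one]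
  omega

end MvPolynomial

/-! ### Grading on a quotient by a homogeneous ideal -/

section QuotientGrading

open DirectSum

variable {k A ι : Type*} [CommRing k] [CommRing A] [Algebra k A]

theorem gradedMonoid_map_mkₐ [AddMonoid ι] (𝒜 : ι → Submodule k A) [SetLike.GradedMonoid 𝒜]
    (I : Ideal A) :
    SetLike.GradedMonoid fun i => (𝒜 i).map (Ideal.Quotient.mkₐ k I).toLinearMap where
  one_mem := ⟨1, SetLike.GradedOne.one_mem, map_one (Ideal.Quotient.mkₐ k I)⟩
  mul_mem := by
    rintro i j _ _ ⟨a, ha, rfl⟩ ⟨b, hb, rfl⟩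
    exact ⟨a * b, SetLike.GradedMul.mul_mem ha hb, map_mul (Ideal.Quotient.mkₐ k I) a b⟩

/-- The decomposition of the quotient of a graded algebra by a homogeneous ideal. -/
@[reducible] noncomputable def decompositionMapMkₐ [AddMonoid ι] [DecidableEq ι]
    (𝒜 : ι → Submodule k A) [GradedAlgebra 𝒜] {I : Ideal A} (hI : I.IsHomogeneous 𝒜) :
    Decomposition fun i => (𝒜 i).map (Ideal.Quotient.mkₐ k I).toLinearMap :=
  let φ : (⨁ i, 𝒜 i) →+ ⨁ i, (𝒜 i).map (Ideal.Quotient.mkₐ k I).toLinearMap :=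
    DirectSum.map fun i =>
      ((Ideal.Quotient.mkₐ k I).toLinearMap.submoduleMap (𝒜 i)).toAddMonoidHom
  let ψ : A ⧸ I →+ ⨁ i, (𝒜 i).map (Ideal.Quotient.mkₐ k I).toLinearMap :=
    QuotientAddGroup.lift I.toAddSubgroup (φ.comp (decomposeAddEquiv 𝒜).toAddMonoidHom) <| by
      intro x hx
      refine DFinsupp.ext fun i => Subtype.ext ?_
      exact Ideal.Quotient.eq_zero_iff_mem.2 (hI i hx)
  have hψ (i : ι) (a : A) (ha : a ∈ 𝒜 i) : ψ (Ideal.Quotient.mk I a) =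
      of (fun i => (𝒜 i).map (Ideal.Quotient.mkₐ k I).toLinearMap) i
        ⟨Ideal.Quotient.mk I a, a, ha, rfl⟩ := by
    change φ (decompose 𝒜 a) = _
    rw [decompose_of_mem 𝒜 ha]
    exact DirectSum.map_of _ _ _
  Decomposition.ofAddHom _ ψ
    (by
      refine AddMonoidHom.ext fun x => ?_
      obtain ⟨a, rfl⟩ := Ideal.Quotient.mk_surjective x
      induction a using Decomposition.inductionOn 𝒜 with
      | zero => simp
      | homogeneous a =>
        rw [AddMonoidHom.comp_apply, hψ _ _ a.2, coeAddMonoidHom_of]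
        rfl
      | add a b ha hb => rw [map_add, map_add, ha, hb, map_add])
    (by
      refine DirectSum.addHom_ext' fun i => AddMonoidHom.ext ?_
      rintro ⟨_, a, ha, rfl⟩
      simp only [AddMonoidHom.comp_apply, coeAddMonoidHom_of]
      exact hψ i a ha)

theorem nonempty_gradedAlgebra_map_mkₐ [AddMonoid ι] [DecidableEq ι]
    (𝒜 : ι → Submodule k A) [GradedAlgebra 𝒜] {I : Ideal A} (hI : I.IsHomogeneous 𝒜) :
    Nonempty (GradedAlgebra fun i => (𝒜 i).map (Ideal.Quotient.mkₐ k I).toLinearMap) :=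
  ⟨{ gradedMonoid_map_mkₐ 𝒜 I, decompositionMapMkₐ 𝒜 hI with }⟩

end QuotientGrading

/-! ### Divisibility in integral extensions and `K`-primes -/

/-- In an integral extension of an integrally closed domain, divisibility between elements of the
base is the divisibility in the base. -/
theorem dvd_of_map_dvd_map_of_isIntegral {S R : Type*} [CommRing S] [IsDomain S]
    [IsIntegrallyClosed S] [CommRing R] [IsDomain R] {φ : S →+* R} (hφ : Function.Injective φ)
    (hint : φ.IsIntegral) {a b : S} (h : φ a ∣ φ b) : a ∣ b := by
  obtain ⟨c, hc⟩ := h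
  by_cases ha : a = 0
  · subst ha
    rw [map_zero, zero_mul, map_eq_zero_iff φ hφ] at hc
    rw [hc]
  let F := FractionRing S
  let L := FractionRing R
  let ψ : S →+* L := (algebraMap R L).comp φ
  have hψ : Function.Injective ψ := (IsFractionRing.injective R L).comp hφ
  let χ : F →+* L := IsFractionRing.lift hψ
  have hχ (s : S) : χ (algebraMap S F s) = ψ s := IsFractionRing.lift_algebraMap hψ s
  have ha' : ψ a ≠ 0 := (map_ne_zero_iff ψ hψ).2 ha
  have hcχ : χ (algebraMap S F b / algebraMap S F a) = algebraMap R L c := by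
    rw [map_div₀, hχ, hχ, div_eq_iff ha', mul_comm]
    change algebraMap R L (φ b) = algebraMap R L (φ a) * _
    rw [hc, map_mul]
  obtain ⟨p, hp, hpc⟩ := hint c
  -- The quotient `b / a` maps to `c` under the injection `χ` of fraction fields, so it satisfies
  -- the monic equation of `c`.
  have hz : IsIntegral S (algebraMap S F b / algebraMap S F a) := by
    refine ⟨p, hp, χ.injective ?_⟩
    rw [Polynomial.hom_eval₂, hcχ, map_zero]
    have : χ.comp (algebraMap S F) = (algebraMap R L).comp φ := RingHom.ext hχ
    rw [this, ← Polynomial.hom_eval₂, hpc, map_zero]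
  obtain ⟨q, hq⟩ := IsIntegrallyClosed.isIntegral_iff.1 hz
  refine ⟨q, IsFractionRing.injective S F ?_⟩
  rw [map_mul, hq, mul_div_cancel₀]
  exact (map_ne_zero_iff _ (IsFractionRing.injective S F)).2 ha

theorem IsGradedPrime.smul {k R K : Type*} [Field k] [CommRing R] [Algebra k R] [AddCommGroup K]
    {𝒜 : K → Submodule k R} {f : R} (hf : IsGradedPrime 𝒜 f) {c : k} (hc : c ≠ 0) :
    IsGradedPrime 𝒜 (c • f) := by
  have hu : IsUnit (algebraMap k R c) := (isUnit_iff_ne_zero.2 hc).map _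
  obtain ⟨w, hw⟩ := hf.homogeneous
  refine ⟨⟨w, (𝒜 w).smul_mem c hw⟩, ?_, ?_, fun g h hg hh hgh => ?_⟩
  · rw [smul_ne_zero_iff]
    exact ⟨hc, hf.ne_zero⟩
  · rw [Algebra.smul_def]
    exact fun h => hf.not_isUnit (isUnit_of_mul_isUnit_right h)
  · rw [Algebra.smul_def, hu.mul_left_dvd] at *
    rw [hu.mul_left_dvd]
    exact hf.dvd_or_dvd g h hg hh hgh

theorem Prime.isGradedPrime {k R K : Type*} [CommRing k] [CommRing R] [Algebra k R]
    [AddCommGroup K] {𝒜 : K → Submodule k R} {f : R} (hf : Prime f)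
    (hom : SetLike.IsHomogeneousElem 𝒜 f) : IsGradedPrime 𝒜 f :=
  ⟨hom, hf.ne_zero, hf.not_isUnit, fun _ _ _ _ => hf.dvd_or_dvd⟩

/-! ### The ring `R`, its grading and its variables -/

namespace Brieskorn

open MvPolynomial

variable {m : Fin 4 → ℕ}

theorem prime_poly (hm : ∀ i, m i ≠ 0) : Prime (poly m) :=
  prime_sum_X_pow hm (s := Finset.univ) (by simp)

theorem isDomain_ring (hm : ∀ i, m i ≠ 0) : IsDomain (Ring m) := by
  have : (Ideal.span {poly m}).IsPrime :=
    (Ideal.span_singleton_prime (prime_poly hm).ne_zero).2 (prime_poly hm)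
  exact Ideal.Quotient.isDomain _

theorem isIntegrallyClosed_ring (hm : ∀ i, m i ≠ 0) : IsIntegrallyClosed (Ring m) :=
  isIntegrallyClosed_quotient_sum_X_pow hm (s := Finset.univ) (by simp)

theorem exists_of_mem_lattice {v : Fin 4 → ℤ} (hv : v ∈ lattice m) :
    ∃ c : Fin 4 → ℤ, ∑ i, c i = 0 ∧ ∀ i, v i = c i * m i := by
  induction hv using AddSubgroup.closure_induction with
  | mem x hx =>
    rcases hx with rfl | rfl | rfl
    · exact ⟨![-1, 1, 0, 0], by simp [Fin.sum_univ_succ], fun i => by fin_cases i <;> simp⟩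
    · exact ⟨![-1, 0, 1, 0], by simp [Fin.sum_univ_succ], fun i => by fin_cases i <;> simp⟩
    · exact ⟨![-1, 0, 0, 1], by simp [Fin.sum_univ_succ], fun i => by fin_cases i <;> simp⟩
  | zero => exact ⟨0, by simp, by simp⟩
  | add x y _ _ hx hy =>
    obtain ⟨c, hc, hx⟩ := hx
    obtain ⟨d, hd, hy⟩ := hy
    exact ⟨c + d, by simp [Finset.sum_add_distrib, hc, hd], fun i => by simp [hx, hy, add_mul]⟩
  | neg x _ hx =>
    obtain ⟨c, hc, hx⟩ := hx
    exact ⟨-c, by simp [hc], fun i => by simp [hx]⟩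

theorem smul_degree (i : Fin 4) : m i • degree m i = m 0 • degree m 0 := by
  rw [eq_comm, degree, degree, ← QuotientAddGroup.mk_nsmul, ← QuotientAddGroup.mk_nsmul,
    QuotientAddGroup.eq]
  fin_cases i
  · simp
  · refine AddSubgroup.subset_closure (Or.inl ?_)
    ext j; fin_cases j <;> simp
  · refine AddSubgroup.subset_closure (Or.inr (Or.inl ?_))
    ext j; fin_cases j <;> simp
  · refine AddSubgroup.subset_closure (Or.inr (Or.inr ?_))
    ext j; fin_cases j <;> simp

theorem isWeightedHomogeneous_poly (m : Fin 4 → ℕ) :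
    IsWeightedHomogeneous (degree m) (poly m) (m 0 • degree m 0) := by
  refine IsWeightedHomogeneous.sum _ _ _ fun i _ => ?_
  rw [← smul_degree i]
  exact (isWeightedHomogeneous_X ℂ (degree m) i).pow (m i)

theorem weight_degree (a : Fin 4 →₀ ℕ) :
    Finsupp.weight (degree m) a = QuotientAddGroup.mk fun i => (a i : ℤ) := by
  rw [Finsupp.weight_apply, Finsupp.sum_fintype _ _ (by simp)]
  simp only [degree, ← QuotientAddGroup.mk_nsmul]
  rw [← QuotientAddGroup.mk_sum]
  congr 1
  ext j
  simp [Finset.sum_apply, Pi.single_apply]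

/-- The exponents differ by `c_i m_i` with `∑ c_i = 0`: residues are unchanged, and each quotient
moves by `c_i`. -/
theorem mod_eq_and_sum_div_eq (hm : ∀ i, m i ≠ 0) {a b : Fin 4 →₀ ℕ}
    (h : Finsupp.weight (degree m) a = Finsupp.weight (degree m) b) :
    (∀ i, a i % m i = b i % m i) ∧ ∑ i, a i / m i = ∑ i, b i / m i := by
  rw [weight_degree, weight_degree, QuotientAddGroup.eq] at h
  obtain ⟨c, hc, h⟩ := exists_of_mem_lattice h
  have h' (i : Fin 4) : (b i : ℤ) = a i + c i * m i := by
    rw [← h i]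
    simp
  constructor
  · intro i
    zify
    rw [h' i, Int.add_mul_emod_self_right]
  · zify
    have (i : Fin 4) : (b i : ℤ) / m i = a i / m i + c i := by
      rw [h' i, Int.add_mul_ediv_right _ _ (by exact_mod_cast hm i)]
    simp only [this, Finset.sum_add_distrib, hc, add_zero]

theorem nonempty_gradedAlgebra [DecidableEq (DegreeGroup m)] :
    Nonempty (GradedAlgebra (grading m)) := by
  let := weightedGradedAlgebra ℂ (degree m)
  refine nonempty_gradedAlgebra_map_mkₐ (weightedHomogeneousSubmodule ℂ (degree m))
    (Ideal.homogeneous_span _ _ ?_)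
  rintro _ rfl
  exact ⟨_, isWeightedHomogeneous_poly m⟩

instance : SetLike.GradedMonoid (grading m) := by
  classical
  let := weightedGradedAlgebra ℂ (degree m)
  exact gradedMonoid_map_mkₐ (weightedHomogeneousSubmodule ℂ (degree m)) _

theorem var_mem_grading (i : Fin 4) : var m i ∈ grading m (degree m i) :=
  ⟨X i, isWeightedHomogeneous_X ℂ (degree m) i, rfl⟩

theorem prime_var (hm : ∀ i, m i ≠ 0) (i : Fin 4) : Prime (var m i) := by
  let e : MvPolynomial (Fin 4) ℂ →ₐ[ℂ] MvPolynomial (Fin 4) ℂ :=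
    aeval fun j => if j = i then 0 else X j
  have heX (p : MvPolynomial (Fin 4) ℂ) : X i ∣ p - e p := by
    rw [← Ideal.mem_span_singleton, ← Ideal.Quotient.eq]
    refine congrFun (congrArg DFunLike.coe (MvPolynomial.algHom_ext
      (f := Ideal.Quotient.mkₐ ℂ (Ideal.span {(X i : MvPolynomial (Fin 4) ℂ)}))
      (g := (Ideal.Quotient.mkₐ ℂ (Ideal.span {X i})).comp e) fun j => ?_)) p
    simp only [AlgHom.comp_apply, e, aeval_X, Ideal.Quotient.mkₐ_eq_mk]
    split_ifs with h
    · rw [h, map_zero, Ideal.Quotient.eq_zero_iff_mem]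
      exact Ideal.mem_span_singleton_self _
    · rfl
  have hei : e (X i) = 0 := by simp [e]
  have heg : e (poly m) = ∑ j ∈ Finset.univ.erase i, X j ^ m j := by
    rw [poly, ← Finset.add_sum_erase _ _ (Finset.mem_univ i), map_add, map_pow, hei,
      zero_pow (hm i), zero_add, map_sum]
    refine Finset.sum_congr rfl fun j hj => ?_
    simp [e, Finset.ne_of_mem_erase hj]
  have hprime : Prime (e (poly m)) := by
    rw [heg]
    exact prime_sum_X_pow hm (by simp)
  -- This is the identification of `R / T_i` with the polynomials free of `X i` modulo `g` at `X i =
  -- 0`.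
  have hdvd (p : MvPolynomial (Fin 4) ℂ) :
      var m i ∣ Ideal.Quotient.mk _ p ↔ e (poly m) ∣ e p := by
    constructor
    · rintro ⟨c, hc⟩
      obtain ⟨c, rfl⟩ := Ideal.Quotient.mk_surjective c
      rw [var, ← map_mul, Ideal.Quotient.eq, Ideal.mem_span_singleton] at hc
      have := map_dvd e hc
      rwa [map_sub, map_mul, hei, zero_mul, sub_zero] at this
    · rintro ⟨q, hq⟩
      have h1 : X i ∣ p - poly m * q := by
        have : p - poly m * q = (p - e p) - (poly m - e (poly m)) * q := by rw [hq]; ring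
        rw [this]
        exact dvd_sub (heX p) ((heX (poly m)).mul_right q)
      have h2 := map_dvd (Ideal.Quotient.mk (Ideal.span {poly m})) h1
      rwa [map_sub, map_mul, Ideal.Quotient.eq_zero_iff_mem.2 (Ideal.mem_span_singleton_self _),
        zero_mul, sub_zero] at h2
  refine ⟨?_, fun hu => ?_, fun a b hab => ?_⟩
  · intro h0
    rw [var, Ideal.Quotient.eq_zero_iff_mem, Ideal.mem_span_singleton] at h0
    obtain ⟨j, hj⟩ := exists_ne i
    exact not_X_dvd_sum_X_pow hm (Finset.mem_univ j) hj.symm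
      (((prime_X_var i).irreducible.dvd_iff.1 h0).resolve_left (prime_poly hm).not_isUnit).dvd
  · have := (hdvd 1).1 (by rw [map_one]; exact hu.dvd)
    rw [map_one] at this
    exact hprime.not_isUnit (isUnit_of_dvd_one this)
  · obtain ⟨a, rfl⟩ := Ideal.Quotient.mk_surjective a
    obtain ⟨b, rfl⟩ := Ideal.Quotient.mk_surjective b
    rw [← map_mul, hdvd, map_mul] at hab
    rw [hdvd, hdvd]
    exact hprime.dvd_or_dvd hab

/-! ### The polynomial subring generated by the powers `T_j ^ m_j` -/

/-- The homomorphism sending the `j`-th variable to the class of `Tⱼ ^ mⱼ`. -/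
noncomputable def powHom (m : Fin 4 → ℕ) : MvPolynomial (Fin 3) ℂ →ₐ[ℂ] Ring m :=
  aeval fun j => var m j.castSucc ^ m j.castSucc

/-- The linear form that `powHom` sends to the class of `Tᵢ ^ mᵢ`. -/
noncomputable def linForm : Fin 4 → MvPolynomial (Fin 3) ℂ :=
  Fin.lastCases (-∑ j, X j) X

theorem sum_var_pow (m : Fin 4 → ℕ) : ∑ i, var m i ^ m i = 0 := by
  have h0 : Ideal.Quotient.mk (Ideal.span {poly m}) (∑ i, X i ^ m i) = 0 :=
    Ideal.Quotient.eq_zero_iff_mem.2 (Ideal.mem_span_singleton_self _)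
  simp only [map_sum, map_pow] at h0
  exact h0

theorem powHom_linForm (i : Fin 4) : powHom m (linForm i) = var m i ^ m i := by
  induction i using Fin.lastCases with
  | last =>
    have h0 := sum_var_pow m
    rw [Fin.sum_univ_castSucc] at h0
    simp only [linForm, Fin.lastCases_last, map_neg, map_sum, powHom, aeval_X]
    exact neg_eq_of_add_eq_zero_right h0
  | cast j => simp [linForm, powHom]

theorem isHomogeneous_linForm (i : Fin 4) : (linForm i).IsHomogeneous 1 := by
  induction i using Fin.lastCases with
  | last =>
    simp only [linForm, Fin.lastCases_last]
    exact (IsHomogeneous.sum _ _ _ fun j _ => isHomogeneous_X ℂ j).neg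
  | cast j =>
    simp only [linForm, Fin.lastCases_castSucc]
    exact isHomogeneous_X ℂ j

theorem irreducible_linForm (i : Fin 4) : Irreducible (linForm i) := by
  induction i using Fin.lastCases with
  | last =>
    simp only [linForm, Fin.lastCases_last]
    have := prime_sum_X_pow (k := ℂ) (m := fun _ : Fin 3 => 1) (by simp) (s := Finset.univ) (by simp)
    simp only [pow_one] at this
    exact this.neg.irreducible
  | cast j =>
    simp only [linForm, Fin.lastCases_castSucc]
    exact (prime_X_var j).irreducible

/-- Extracting roots lifts every `y ∈ ℂ³` to a point `t` of the hypersurface, so a polynomial in the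
kernel vanishes at every `y`. -/
theorem powHom_injective (hm : ∀ i, m i ≠ 0) : Function.Injective (powHom m) := by
  rw [injective_iff_map_eq_zero]
  intro p hp
  refine MvPolynomial.funext fun y => ?_
  have hroot (i : Fin 4) : ∃ t : ℂ, t ^ m i = Fin.lastCases (-∑ j, y j) y i :=
    IsAlgClosed.exists_pow_nat_eq _ (Nat.pos_of_ne_zero (hm i))
  choose t ht using hroot
  let ev : Ring m →ₐ[ℂ] ℂ := Ideal.Quotient.liftₐ _ (aeval t) <| by
    intro a ha
    obtain ⟨b, rfl⟩ := Ideal.mem_span_singleton.1 ha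
    rw [map_mul, poly, map_sum]
    simp only [map_pow, aeval_X, ht]
    rw [Fin.sum_univ_castSucc]
    simp only [Fin.lastCases_castSucc, Fin.lastCases_last, add_neg_cancel, zero_mul]
  have hev (i : Fin 4) : ev (var m i) = t i := by
    change aeval t (X i) = t i
    rw [aeval_X]
  have : ev.comp (powHom m) = aeval y := by
    refine algHom_ext fun j => ?_
    simp [powHom, hev, ht]
  have h := congrArg ev hp
  rw [← AlgHom.comp_apply, this, map_zero] at h
  rw [map_zero, ← h]
  rfl

theorem powHom_isIntegral (hm : ∀ i, m i ≠ 0) : (powHom m).toRingHom.IsIntegral := by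
  let := (powHom m).toRingHom.toAlgebra
  intro a
  change IsIntegral (MvPolynomial (Fin 3) ℂ) a
  obtain ⟨p, rfl⟩ := Ideal.Quotient.mk_surjective a
  have hvar (i : Fin 4) : IsIntegral (MvPolynomial (Fin 3) ℂ) (var m i) := by
    refine IsIntegral.of_pow (Nat.pos_of_ne_zero (hm i)) ?_
    rw [← powHom_linForm i]
    exact isIntegral_algebraMap
  induction p using MvPolynomial.induction_on with
  | C c =>
    have : Ideal.Quotient.mk (Ideal.span {poly m}) (C c) = powHom m (C c) :=
      ((powHom m).commutes c).symm
    rw [this]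
    exact isIntegral_algebraMap
  | add p q hp hq => rw [map_add]; exact hp.add hq
  | mul_X p i hp => rw [map_mul]; exact hp.mul (hvar i)

theorem dvd_of_powHom_dvd (hm : ∀ i, m i ≠ 0) {f g : MvPolynomial (Fin 3) ℂ}
    (h : powHom m f ∣ powHom m g) : f ∣ g :=
  have := isDomain_ring hm
  dvd_of_map_dvd_map_of_isIntegral (φ := (powHom m).toRingHom) (powHom_injective hm)
    (powHom_isIntegral hm) h

theorem powHom_mem_grading {F : MvPolynomial (Fin 3) ℂ} {d : ℕ} (hF : F.IsHomogeneous d) :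
    powHom m F ∈ grading m (d • m 0 • degree m 0) := by
  rw [F.as_sum, map_sum]
  refine Submodule.sum_mem _ fun e he => ?_
  rw [powHom, aeval_monomial, ← Algebra.smul_def, Finsupp.prod_fintype _ _ (by simp)]
  refine Submodule.smul_mem _ _ ?_
  have hd : d • m 0 • degree m 0 = ∑ j, e j • m (Fin.castSucc j) • degree m j.castSucc := by
    simp only [smul_degree]
    rw [← Finset.sum_smul]
    congr 1
    rw [hF.degree_eq_sum_deg_support he, Finset.sum_subset (Finset.subset_univ _)
      fun j _ hj => Finsupp.notMem_support_iff.1 hj]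
  rw [hd]
  exact SetLike.prod_mem_graded _ _ _ fun j _ => SetLike.pow_mem_graded _
    (SetLike.pow_mem_graded _ (var_mem_grading _))

theorem exists_eq_prod_var_mul_powHom (hm : ∀ i, m i ≠ 0) {a : Ring m}
    (ha : SetLike.IsHomogeneousElem (grading m) a) :
    ∃ (r : Fin 4 → ℕ) (d : ℕ) (F : MvPolynomial (Fin 3) ℂ), F.IsHomogeneous d ∧
      a = (∏ i, var m i ^ r i) * powHom m F := by
  obtain ⟨w, p, hp, rfl⟩ := ha
  by_cases h0 : p = 0
  · subst h0
    exact ⟨0, 0, 0, isHomogeneous_zero _ _ _, by simp⟩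
  obtain ⟨b, hb⟩ := support_nonempty.2 h0
  -- By `mod_eq_and_sum_div_eq`, residues and total quotient do not depend on the chosen monomial
  -- `b`. The quotient parts become powers of the linear forms.
  refine ⟨fun i => b i % m i, ∑ i, b i / m i,
    ∑ e ∈ p.support, C (coeff e p) * ∏ i, linForm i ^ (e i / m i), ?_, ?_⟩
  · refine IsHomogeneous.sum _ _ _ fun e he => ?_
    have hw := (hp (mem_support_iff.1 he)).trans (hp (mem_support_iff.1 hb)).symm
    rw [← (mod_eq_and_sum_div_eq hm hw).2]
    refine IsHomogeneous.C_mul (IsHomogeneous.prod _ _ _ fun i _ => ?_) _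
    simpa using (isHomogeneous_linForm i).pow (e i / m i)
  · conv_lhs => rw [p.as_sum]
    rw [map_sum, map_sum, Finset.mul_sum]
    refine Finset.sum_congr rfl fun e he => ?_
    have hw := (hp (mem_support_iff.1 he)).trans (hp (mem_support_iff.1 hb)).symm
    have h1 := (mod_eq_and_sum_div_eq hm hw).1
    have h2 : powHom m (C (coeff e p)) = Ideal.Quotient.mk _ (C (coeff e p)) :=
      (powHom m).commutes _
    rw [map_mul, map_prod, mul_left_comm, ← Finset.prod_mul_distrib, h2, monomial_eq,
      Finsupp.prod_fintype _ _ (by simp)]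
    change Ideal.Quotient.mk _ _ = _
    rw [map_mul, map_prod]
    congr 1
    refine Finset.prod_congr rfl fun i _ => ?_
    beta_reduce
    rw [map_pow, map_pow, powHom_linForm, ← pow_mul, ← pow_add, ← h1 i, Nat.mod_add_div]
    rfl

/-- The exponent `∏ m_i` is divisible by every `m_i`, which brings the monomial factor into the
image of `powHom`. -/
theorem prod_var_mul_powHom_pow (r : Fin 4 → ℕ) (F : MvPolynomial (Fin 3) ℂ) :
    ((∏ i, var m i ^ r i) * powHom m F) ^ (∏ i, m i) =
      powHom m ((∏ i, linForm i ^ (r i * ∏ j ∈ Finset.univ.erase i, m j)) * F ^ (∏ i, m i)) := by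
  rw [mul_pow, map_mul, map_pow, map_prod, ← Finset.prod_pow]
  congr 1
  refine Finset.prod_congr rfl fun i _ => ?_
  rw [map_pow, powHom_linForm, ← Finset.mul_prod_erase _ _ (Finset.mem_univ i)]
  ring

/-- Raising `a * b` to the power `∏ m_i` moves the divisibility into the image of `powHom`, where it
descends to polynomials. There `f` is prime and misses the linear forms, so it divides `F` or `G`.
The forms are excluded because they map to `T_i ^ m_i`, which need not be `K`-prime. -/
theorem isGradedPrime_powHom (hm : ∀ i, m i ≠ 0) {f : MvPolynomial (Fin 3) ℂ} (hf : Prime f)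
    {d : ℕ} (hd : f.IsHomogeneous d) (hfl : ∀ i, ¬ f ∣ linForm i) :
    IsGradedPrime (grading m) (powHom m f) := by
  have := isDomain_ring hm
  refine ⟨⟨_, powHom_mem_grading hd⟩, ?_, ?_, fun a b ha hb hab => ?_⟩
  · exact (map_ne_zero_iff _ (powHom_injective hm)).2 hf.ne_zero
  · intro hu
    refine hf.not_isUnit (isUnit_of_dvd_one (dvd_of_powHom_dvd hm ?_))
    rw [map_one]
    exact hu.dvd
  · obtain ⟨r, _, F, -, rfl⟩ := exists_eq_prod_var_mul_powHom hm ha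
    obtain ⟨s, _, G, -, rfl⟩ := exists_eq_prod_var_mul_powHom hm hb
    have hN : ∏ i, m i ≠ 0 := Finset.prod_ne_zero_iff.2 fun i _ => hm i
    have h := dvd_pow hab hN
    rw [mul_pow, prod_var_mul_powHom_pow, prod_var_mul_powHom_pow, ← map_mul] at h
    have hl (t : Fin 4 → ℕ) : ¬ f ∣ ∏ i, linForm i ^ t i := by
      intro h
      obtain ⟨i, -, hi⟩ := hf.exists_mem_finset_dvd h
      exact hfl i (hf.dvd_of_dvd_pow hi)
    rcases hf.dvd_or_dvd (dvd_of_powHom_dvd hm h) with h | h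
    · exact Or.inl ((map_dvd (powHom m)
        (hf.dvd_of_dvd_pow ((hf.dvd_or_dvd h).resolve_left (hl _)))).mul_left _)
    · exact Or.inr ((map_dvd (powHom m)
        (hf.dvd_of_dvd_pow ((hf.dvd_or_dvd h).resolve_left (hl _)))).mul_left _)

theorem isGradedPrime_var (hm : ∀ i, m i ≠ 0) (i : Fin 4) :
    IsGradedPrime (grading m) (var m i) :=
  (prime_var hm i).isGradedPrime ⟨_, var_mem_grading i⟩

/-- The scalar `c` collects the units of the polynomial ring, which are the nonzero constants. -/
theorem exists_multiset_powHom_eq_smul_prod (hm : ∀ i, m i ≠ 0) (F : MvPolynomial (Fin 3) ℂ)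
    (hF : F ≠ 0) {d : ℕ} (hd : F.IsHomogeneous d) :
    ∃ c : ℂ, c ≠ 0 ∧ ∃ s : Multiset (Ring m), (∀ p ∈ s, IsGradedPrime (grading m) p) ∧
      powHom m F = c • s.prod := by
  induction F using UniqueFactorizationMonoid.induction_on_prime generalizing d with
  | h₁ => exact absurd rfl hF
  | h₂ F hu =>
    obtain ⟨c, hc, rfl⟩ := MvPolynomial.isUnit_iff_eq_C_of_isReduced.1 hu
    refine ⟨c, hc.ne_zero, 0, by simp, ?_⟩
    rw [Multiset.prod_zero, ← Algebra.algebraMap_eq_smul_one]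
    exact (powHom m).commutes c
  | h₃ F f hF0 hf ih =>
    obtain ⟨e, he⟩ := hd.exists_of_mul hF
    obtain ⟨d', hd'⟩ := (mul_comm f F ▸ hd).exists_of_mul (mul_comm f F ▸ hF)
    obtain ⟨c, hc, s, hs, h⟩ := ih hF0 hd'
    rw [map_mul, h]
    by_cases hfl : ∃ i, f ∣ linForm i
    · obtain ⟨i, hi⟩ := hfl
      obtain ⟨u, hu⟩ := (hf.irreducible.associated_of_dvd (irreducible_linForm i) hi).symm
      obtain ⟨v, hv, huv⟩ := MvPolynomial.isUnit_iff_eq_C_of_isReduced.1 u.isUnit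
      refine ⟨v * c, mul_ne_zero hv.ne_zero hc, Multiset.replicate (m i) (var m i) + s, ?_, ?_⟩
      · intro p hp
        rcases Multiset.mem_add.1 hp with hp | hp
        · rw [Multiset.eq_of_mem_replicate hp]
          exact isGradedPrime_var hm i
        · exact hs p hp
      · have : powHom m (C v) = algebraMap ℂ _ v := (powHom m).commutes v
        rw [← hu, huv, map_mul, powHom_linForm, Multiset.prod_add, Multiset.prod_replicate, this,
          mul_comm (var m i ^ m i), ← Algebra.smul_def, smul_mul_smul_comm]
    · push Not at hfl
      refine ⟨c, hc, powHom m f ::ₘ s, ?_, ?_⟩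
      · intro p hp
        rcases Multiset.mem_cons.1 hp with rfl | hp
        · exact isGradedPrime_powHom hm hf he hfl
        · exact hs p hp
      · rw [Multiset.prod_cons, mul_smul_comm]

theorem isFactoriallyGraded_grading (hm : ∀ i, m i ≠ 0) : IsFactoriallyGraded (grading m) := by
  have := isDomain_ring hm
  refine ⟨@nonempty_gradedAlgebra m (_), fun g h _ _ => mul_eq_zero.1, fun f hf hf0 hfu => ?_⟩
  obtain ⟨r, d, F, hF, rfl⟩ := exists_eq_prod_var_mul_powHom hm hf
  have hF0 : F ≠ 0 := by
    rintro rfl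
    exact hf0 (by rw [map_zero, mul_zero])
  obtain ⟨c, hc, s, hs, h⟩ := exists_multiset_powHom_eq_smul_prod hm F hF0 hF
  obtain ⟨t, ht, hprod⟩ : ∃ t : Multiset (Ring m), (∀ p ∈ t, IsGradedPrime (grading m) p) ∧
      (∏ i, var m i ^ r i) * powHom m F = c • t.prod := by
    refine ⟨(∑ i, Multiset.replicate (r i) (var m i)) + s, fun p hp => ?_, ?_⟩
    · rcases Multiset.mem_add.1 hp with hp | hp
      · obtain ⟨i, -, hi⟩ := Multiset.mem_sum.1 hp
        rw [Multiset.eq_of_mem_replicate hi]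
        exact isGradedPrime_var hm i
      · exact hs p hp
    · rw [h, Multiset.prod_add, Multiset.prod_sum]
      simp only [Multiset.prod_replicate, mul_smul_comm]
  rw [hprod] at hfu ⊢
  -- The scalar is absorbed into one factor. An empty product is impossible because `f` is not a
  -- unit.
  induction t using Multiset.induction_on with
  | empty =>
    refine absurd ?_ hfu
    rw [Multiset.prod_zero, ← Algebra.algebraMap_eq_smul_one]
    exact (isUnit_iff_ne_zero.2 hc).map _
  | cons p t _ =>
    refine ⟨(c • p) ::ₘ t, fun q hq => ?_, by rw [Multiset.prod_cons, Multiset.prod_cons,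
      smul_mul_assoc]⟩
    rcases Multiset.mem_cons.1 hq with rfl | hq
    · exact (ht p (Multiset.mem_cons_self p t)).smul hc
    · exact ht q (Multiset.mem_cons_of_mem hq)

end Brieskorn

theorem mainTheorem7 (m : Fin 4 → ℕ) (hm : ∀ i, 1 ≤ m i) :
    IsDomain (Brieskorn.Ring m) ∧
    IsIntegrallyClosed (Brieskorn.Ring m) ∧
    MvPolynomial.IsWeightedHomogeneous (Brieskorn.degree m) (Brieskorn.poly m)
      (m 0 • Brieskorn.degree m 0) ∧
    (∀ i, Brieskorn.var m i ∈ Brieskorn.grading m (Brieskorn.degree m i)) ∧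
    (∀ i, Prime (Brieskorn.var m i)) ∧
    IsFactoriallyGraded (Brieskorn.grading m) := by
  have hm' (i : Fin 4) : m i ≠ 0 := Nat.one_le_iff_ne_zero.1 (hm i)
  exact ⟨Brieskorn.isDomain_ring hm', Brieskorn.isIntegrallyClosed_ring hm',
    Brieskorn.isWeightedHomogeneous_poly m, Brieskorn.var_mem_grading, Brieskorn.prime_var hm',
    Brieskorn.isFactoriallyGraded_grading hm'⟩
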